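/- Setting. Let $f,\theta_1,\dots,\theta_s\in\mathbb R[y]$, $y=(y_1,\dots,y_\ell)$, let $G(x)$ be a symmetric $q\times q$ polynomial matrix in $x=(x_1,\dots,x_n)$, and let $P(y,x)$ be a symmetric $m\times m$ polynomial matrix in $(y,x)$. Put $\mathcal Y=\{y\in\mathbb R^\ell:\theta_1(y)\ge 0,\dots,\theta_s(y)\ge 0\}$, $\mathcal X=\{x\in\mathbb R^n: G(x)\succeq 0\}$, and consider $$f^\star=\inf\{f(y)\,:\, y\in\mathcal Y,\ P(y,x)\succeq 0\ \ \forall x\in\mathcal X\}.\qquad (1)$$ Degrees of polynomial matrices are maxima over the entries. Put $d_G=\lceil\deg(G)/2\rceil$, $\Theta=\mathrm{diag}(\theta_1,\dots,\theta_s)$, $d_\Theta=\lceil\deg(\Theta)/2\rceil$ (with $d_\Theta=0$ if $s=0$), $k_y=\max\{\deg f,\deg\theta_i,\deg_y P_{ij}\}$, $k_x=\max\{\deg_x P_{ij},\deg G\}$. Cones. An SOS matrix is a polynomial matrix of the form $T^{\top}T$. For an $mq\times mq$ matrix $A$ and a $q\times q$ matrix $B$ let $(A,B)_m=\mathrm{Tr}_m(A^{\top}(I_m\otimes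 B))$, where $\mathrm{Tr}_m$ replaces each $q\times q$ block by its trace. Let $\mathcal Q^m_k(G)=\{\Sigma_0+(\Sigma_1,G)_m : \Sigma_0,\Sigma_1 \text{ SOS matrices of sizes } m, mq;\ \deg\Sigma_0,\ \deg(\Sigma_1,G)_m\le 2k\}$. For a sequence $S=(S_\alpha)$ of symmetric $m\times m$ matrices, the moment matrix $M_d(S)$ has the blocks $S_{\alpha+\beta}$ and the localizing matrix $M_d(GS)$ has the blocks $\sum_\gamma S_{\alpha+\beta+\gamma}\otimes G_\gamma$, for $|\alpha|,|\beta|\le d$, where $G(x)=\sum_\gamma G_\gamma x^\gamma$. For $k\ge d_G$ let $\mathcal M^m_k(G)$ be the set of sequences $(S_\alpha)_{|\alpha|\le 2k}$ of symmetric $m\times m$ matrices with $M_k(S)\succeq0$ and $M_{k-d_G}(GS)\succeq 0$. Let $\mathcal Q_k(\Theta)$, $\mathcal M_k(\Theta)$ be the same objects in the variables $y$ for $m=1$ and the matrix $\Theta$. Write $\mathscr L_S(P)=\sum_\alpha \mathrm{tr}(P_\alpha(y)S_\alpha)\in\mathbb R[y]$ if $P=\sum_\alpha P_\alpha(y)x^\alpha$;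 $\mathscr H_{\mathbf s}(P)=\sum_\beta s_\beta P_\beta(x)$ if $P=\sum_\beta P_\beta(x)y^\beta$; and $\mathscr H_{\mathbf s}(h)=\sum_\beta h_\beta s_\beta$ for $h\in\mathbb R[y]$. Relaxations. For $k\ge\max\{\lceil k_x/2\rceil,\lceil k_y/2\rceil\}$ let $$f_k^{\rm primal}=\sup\{\rho: f-\rho-\mathscr L_S(P)\in\mathcal Q_k(\Theta),\ \rho\in\mathbb R,\ S\in\mathcal M^m_k(G)\},$$ $$f_k^{\rm dual}=\inf\{\mathscr H_{\mathbf s}(f): \mathbf s\in\mathcal M_k(\Theta),\ \mathscr H_{\mathbf s}(1)=1,\ \mathscr H_{\mathbf s}(P)\in\mathcal Q^m_k(G)\}.$$ Convexity assumption (C): $f,-\theta_1,\dots,-\theta_s$ are convex on $\mathbb R^\ell$; for every $x\in\mathcal X$, $-P(\cdot,x)$ is PSD-convex, i.e. $tQ(y^{(1)})+(1-t)Q(y^{(2)})\succeq Q(ty^{(1)}+(1-t)y^{(2)})$ for $Q=-P(\cdot,x)$, all $y^{(1)},y^{(2)}\in\mathbb R^\ell$ and $t\in(0,1)$; and $\mathcal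 X$ is compact. Theorem. Let $(\rho^\star,S^\star)$ and $\mathbf s^\star$ be optimal solutions of the primal and of the dual relaxation of some order $k\ge\max\{\lceil k_x/2\rceil,\lceil k_y/2\rceil\}$. Consider the flat extension conditions, with $d_1=\max\{1,d_G\}$ and $d_2=\max\{1,d_\Theta\}$, $$\text{(F1)}\quad \lceil k_x/2\rceil\le t_1\le k,\quad t_1\ge d_1,\quad \mathrm{rank}\,M_{t_1}(S^\star)=\mathrm{rank}\,M_{t_1-d_1}(S^\star);$$ $$\text{(F2)}\quad \lceil k_y/2\rceil\le t_2\le k,\quad t_2\ge d_2,\quad \mathrm{rank}\,M_{t_2}(\mathbf s^\star)=\mathrm{rank}\,M_{t_2-d_2}(\mathbf s^\star).$$ (i) If (F1) holds for some $t_1$, then the truncation $(S^\star_\alpha)_{|\alpha|\le 2t_1}$ has a representing measure $\sum_{i=1}^{r_1}W_i\delta_{x^{(i)}}$ with distinct points $x^{(i)}\in\mathcal X$ and PSD matrices $W_i$, i.e. $S^\star_\alpha=\sum_i (x^{(i)})^\alpha W_i$ for $|\alpha|\le 2t_1$; and $f_k^{\rm primal}\le f^\star$. (ii) If (C) holds and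 (F2) holds for some $t_2$, then the truncation $(s^\star_\alpha)_{|\alpha|\le 2t_2}$ has a representing probability measure $\sum_{j=1}^{r_2}\lambda_j\delta_{y^{(j)}}$ with distinct points $y^{(j)}\in\mathcal Y$ and $\lambda_j>0$; and $f_k^{\rm dual}\ge f^\star$. Consequently, if (C) holds, (F1) and (F2) hold for some $t_1$ and $t_2$, and $f_k^{\rm primal}=f_k^{\rm dual}$, then (iii) $f_k^{\rm primal}=f_k^{\rm dual}=f^\star$, and for all representing measures as in (i) and (ii): (iv) $\sum_j\lambda_jy^{(j)}$ is an optimal solution of (1); (v) for any decompositions $W_i=\sum_{l=1}^{m_i}v^{(i,l)}(v^{(i,l)})^{\top}$ with $v^{(i,l)}\in\mathbb R^m$ one has $P\big(\sum_j\lambda_jy^{(j)},x^{(i)}\big)v^{(i,l)}=0$ for all $i$ and $l$. -/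

import Mathlib

open MeasureTheory
open scoped Kronecker

namespace RobustPMI

noncomputable section

/-! ## Polynomial matrices -/

/-- Square matrices, indexed by `ι`, of real polynomials in `n` variables. -/
abbrev PolyMat (n : ℕ) (ι : Type) : Type := Matrix ι ι (MvPolynomial (Fin n) ℝ)

/-- The value of a polynomial matrix at a point. -/
def PolyMat.evalAt {n : ℕ} {ι : Type} (M : PolyMat n ι) (x : Fin n → ℝ) : Matrix ι ι ℝ :=
  M.map (MvPolynomial.eval x)

/-- The degree of a polynomial matrix: the maximum of the degrees of its entries. -/
def PolyMat.deg {n : ℕ} {ι : Type} [Fintype ι] (M : PolyMat n ι) : ℕ :=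
  (Finset.univ : Finset (ι × ι)).sup fun p => (M p.1 p.2).totalDegree

/-- `⌈d / 2⌉` for a natural number `d`. -/
def ceilHalf (d : ℕ) : ℕ := (d + 1) / 2

/-- `⌈deg M / 2⌉`; this is `d_G` for `M = G`, and `d_Θ` for `M = diag(θ₁, …, θ_s)`. -/
def PolyMat.halfDeg {n : ℕ} {ι : Type} [Fintype ι] (M : PolyMat n ι) : ℕ := ceilHalf M.deg

/-- SOS matrices: `M = Tᵀ T` for some `l × ι` polynomial matrix `T`. -/
def PolyMat.IsSOS {n : ℕ} {ι : Type} (M : PolyMat n ι) : Prop :=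
  ∃ (l : ℕ) (T : Matrix (Fin l) ι (MvPolynomial (Fin n) ℝ)), M = T.transpose * T

/-- The partial trace `Tr_m(C) = [tr C_{jk}]_{jk}` of a matrix with `m × m` blocks `C_{jk}` of
size `q × q`. -/
def partialTrace {R : Type} [AddCommMonoid R] {m q : ℕ}
    (C : Matrix (Fin m × Fin q) (Fin m × Fin q) R) : Matrix (Fin m) (Fin m) R :=
  Matrix.of fun j k => ∑ a : Fin q, C (j, a) (k, a)

/-- The bilinear map `(A, B)_m = Tr_m(Aᵀ (I_m ⊗ B))`. -/
def blockPairing {n m q : ℕ} (A : PolyMat n (Fin m × Fin q)) (B : PolyMat n (Fin q)) :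
    PolyMat n (Fin m) :=
  partialTrace (A.transpose * ((1 : PolyMat n (Fin m)) ⊗ₖ B))

/-- The `k`-th truncated matrix quadratic module `𝒬ᵐ_k(G)`. -/
def truncQuadModule {n q : ℕ} (m : ℕ) (G : PolyMat n (Fin q)) (k : ℕ) :
    Set (PolyMat n (Fin m)) :=
  {F | ∃ (S₀ : PolyMat n (Fin m)) (S₁ : PolyMat n (Fin m × Fin q)),
      S₀.IsSOS ∧ S₁.IsSOS ∧ S₀.deg ≤ 2 * k ∧ (blockPairing S₁ G).deg ≤ 2 * k ∧
      F = S₀ + blockPairing S₁ G}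

/-- The set `{x ∈ ℝⁿ | G(x) ⪰ 0}`. -/
def psdSet {n q : ℕ} (G : PolyMat n (Fin q)) : Set (Fin n → ℝ) :=
  {x | (G.evalAt x).PosSemidef}

/-! ## Matrix-valued sequences, moment matrices and localizing matrices

A truncated sequence `(S_α)_{|α| ≤ 2k}` is written as a sequence indexed by all multi-indices;
none of the notions below looks at its members with `|α| > 2k`. -/

/-- Sequences of `m × m` real matrices indexed by multi-indices in `ℕⁿ`. -/
abbrev MatSeq (n m : ℕ) : Type := (Fin n →₀ ℕ) → Matrix (Fin m) (Fin m) ℝ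

/-- `ℕⁿ_d`, the multi-indices `α` with `|α| ≤ d`. -/
abbrev MonIdx (n d : ℕ) : Type := {α : Fin n →₀ ℕ // α.degree ≤ d}

instance instFintypeMonIdx (n d : ℕ) : Fintype (MonIdx n d) :=
  (Finsupp.finite_of_degree_le (σ := Fin n) d).fintype

/-- The moment matrix `M_d(S)`, with `(α, β)`-th block `S_{α+β}`, `|α|, |β| ≤ d`. -/
def momentMatrix {n m : ℕ} (d : ℕ) (S : MatSeq n m) :
    Matrix (MonIdx n d × Fin m) (MonIdx n d × Fin m) ℝ :=
  Matrix.of fun i j => S (i.1.1 + j.1.1) i.2 j.2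

/-- The localizing matrix `M_d(G S)`, with `(α, β)`-th block `∑_γ S_{α+β+γ} ⊗ G_γ`,
`|α|, |β| ≤ d`, written out entry by entry. -/
def localizingMatrix {n m q : ℕ} (d : ℕ) (G : PolyMat n (Fin q)) (S : MatSeq n m) :
    Matrix (MonIdx n d × (Fin m × Fin q)) (MonIdx n d × (Fin m × Fin q)) ℝ :=
  Matrix.of fun i j =>
    ∑ γ ∈ (G i.2.2 j.2.2).support,
      S (i.1.1 + j.1.1 + γ) i.2.1 j.2.1 * (G i.2.2 j.2.2).coeff γ

/-- The cone `ℳᵐ_k(G)` of truncated sequences of symmetric matrices. -/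
def momentCone {n m q : ℕ} (k : ℕ) (G : PolyMat n (Fin q)) : Set (MatSeq n m) :=
  {S | (∀ α : Fin n →₀ ℕ, α.degree ≤ 2 * k → (S α).IsSymm) ∧
    (momentMatrix k S).PosSemidef ∧ (localizingMatrix (k - G.halfDeg) G S).PosSemidef}

/-- A real sequence as a sequence of `1 × 1` matrices. -/
def scalarSeq {n : ℕ} (s : (Fin n →₀ ℕ) → ℝ) : MatSeq n 1 := fun α => Matrix.of fun _ _ => s α

/-- The functional `ℋ_s(h) = ∑_α h_α s_α`. -/
def rieszFun {l : ℕ} (s : (Fin l →₀ ℕ) → ℝ) (h : MvPolynomial (Fin l) ℝ) : ℝ :=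
  ∑ α ∈ h.support, h.coeff α * s α

/-- The flatness condition `rank M_t(S) = rank M_{t-d}(S)`, where `t - d ≥ 0`. -/
def FlatAt {n m : ℕ} (S : MatSeq n m) (d t : ℕ) : Prop :=
  d ≤ t ∧ (momentMatrix t S).rank = (momentMatrix (t - d) S).rank

/-! ## Matrix-valued measures -/

/-- An `m × m` matrix `Φ = [φ_{ij}]` of finite signed Borel measures on `ℝⁿ`. -/
abbrev MatMeasure (n m : ℕ) : Type := Matrix (Fin m) (Fin m) (SignedMeasure (Fin n → ℝ))

/-- The value `Φ(A) = [φ_{ij}(A)]`. -/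
def MatMeasure.apply {n m : ℕ} (Φ : MatMeasure n m) (A : Set (Fin n → ℝ)) :
    Matrix (Fin m) (Fin m) ℝ :=
  Matrix.of fun i j => Φ i j A

/-- `Φ` is a PSD symmetric matrix-valued measure on the (closed) set `X`. -/
def MatMeasure.IsPSDOn {n m : ℕ} (Φ : MatMeasure n m) (X : Set (Fin n → ℝ)) : Prop :=
  (∀ A, MeasurableSet A → (Φ.apply A).PosSemidef) ∧
    ∀ A, MeasurableSet A → Disjoint A X → Φ.apply A = 0

/-- `S_α = ∫ x^α dΦ(x)` for all `|α| ≤ D`, all these integrals being finite. -/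
def MatMeasure.Represents {n m : ℕ} (Φ : MatMeasure n m) (S : MatSeq n m) (D : ℕ) : Prop :=
  ∀ α : Fin n →₀ ℕ, α.degree ≤ D → ∀ i j : Fin m,
    VectorMeasure.Integrable (Φ i j) (fun x : Fin n → ℝ => ∏ c, x c ^ α c) ∧
      S α i j = ∫ᵛ x, (∏ c, x c ^ α c) ∂•(Φ i j)

/-- The finitely atomic matrix-valued measure `∑ᵢ Wᵢ δ_{x⁽ⁱ⁾}`. -/
def atomicMatMeasure {n m r : ℕ} (W : Fin r → Matrix (Fin m) (Fin m) ℝ)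
    (x : Fin r → Fin n → ℝ) : MatMeasure n m :=
  Matrix.of fun a b => ∑ i, VectorMeasure.dirac (x i) (W i a b)

/-- `∑ᵢ Wᵢ δ_{x⁽ⁱ⁾}`, with `Wᵢ ⪰ 0` and distinct points `x⁽ⁱ⁾` of `X`, is a PSD matrix-valued
measure on `X` that represents `(S_α)_{|α| ≤ D}`. -/
def IsAtomicMatRep {n m r : ℕ} (X : Set (Fin n → ℝ)) (S : MatSeq n m) (D : ℕ)
    (W : Fin r → Matrix (Fin m) (Fin m) ℝ) (x : Fin r → Fin n → ℝ) : Prop :=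
  (∀ i, (W i).PosSemidef) ∧ Function.Injective x ∧ (∀ i, x i ∈ X) ∧
    (atomicMatMeasure W x).IsPSDOn X ∧ (atomicMatMeasure W x).Represents S D

/-- The finitely atomic measure `∑ⱼ λⱼ δ_{y⁽ʲ⁾}`. -/
def atomicMeasure {l r : ℕ} (w : Fin r → ℝ) (y : Fin r → Fin l → ℝ) : Measure (Fin l → ℝ) :=
  ∑ j, ENNReal.ofReal (w j) • Measure.dirac (y j)

/-- `∑ⱼ λⱼ δ_{y⁽ʲ⁾}`, with `λⱼ > 0` and distinct points `y⁽ʲ⁾` of `Y`, is a probability measure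
on `Y` that represents `(s_α)_{|α| ≤ D}`. -/
def IsAtomicProbRep {l r : ℕ} (Y : Set (Fin l → ℝ)) (s : (Fin l →₀ ℕ) → ℝ) (D : ℕ)
    (w : Fin r → ℝ) (y : Fin r → Fin l → ℝ) : Prop :=
  (∀ j, 0 < w j) ∧ Function.Injective y ∧ (∀ j, y j ∈ Y) ∧
    IsProbabilityMeasure (atomicMeasure w y) ∧ atomicMeasure w y Yᶜ = 0 ∧
    ∀ α : Fin l →₀ ℕ, α.degree ≤ D →
      Integrable (fun v : Fin l → ℝ => ∏ c, v c ^ α c) (atomicMeasure w y) ∧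
        s α = ∫ v, (∏ c, v c ^ α c) ∂(atomicMeasure w y)

/-! ## The robust optimization problem -/

/-- Real polynomials in the variables `y₁, …, y_l` and `x₁, …, x_n`. -/
abbrev PolyYX (l n : ℕ) : Type := MvPolynomial (Fin l ⊕ Fin n) ℝ

/-- The exponent of `y` in a monomial in `(y, x)`. -/
def yPart {l n : ℕ} (γ : Fin l ⊕ Fin n →₀ ℕ) : Fin l →₀ ℕ :=
  (Finsupp.sumFinsuppEquivProdFinsupp γ).1

/-- The exponent of `x` in a monomial in `(y, x)`. -/
def xPart {l n : ℕ} (γ : Fin l ⊕ Fin n →₀ ℕ) : Fin n →₀ ℕ :=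
  (Finsupp.sumFinsuppEquivProdFinsupp γ).2

/-- The degree in `y`. -/
def degY {l n : ℕ} (p : PolyYX l n) : ℕ := p.support.sup fun γ => (yPart γ).degree

/-- The degree in `x`. -/
def degX {l n : ℕ} (p : PolyYX l n) : ℕ := p.support.sup fun γ => (xPart γ).degree

/-- The data of the problem
`inf f(y)  s.t.  θ₁(y) ≥ 0, …, θ_s(y) ≥ 0,  P(y, x) ⪰ 0 for all x with G(x) ⪰ 0`. -/
structure Problem (l n m q s : ℕ) where
  /-- the objective -/
  f : MvPolynomial (Fin l) ℝ
  /-- the polynomials that define the set of decision variables -/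
  θ : Fin s → MvPolynomial (Fin l) ℝ
  /-- the polynomial matrix that defines the uncertainty set -/
  G : PolyMat n (Fin q)
  /-- the robust constraint -/
  P : Matrix (Fin m) (Fin m) (PolyYX l n)
  G_symm : G.IsSymm
  P_symm : P.IsSymm

namespace Problem

variable {l n m q s : ℕ} (pb : Problem l n m q s)

/-- The uncertainty set `𝒳`. -/
def X : Set (Fin n → ℝ) := psdSet pb.G

/-- The set `𝒴`. -/
def Y : Set (Fin l → ℝ) := {y | ∀ i, 0 ≤ MvPolynomial.eval y (pb.θ i)}

/-- The real matrix `P(y, x)`. -/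
def PAt (y : Fin l → ℝ) (x : Fin n → ℝ) : Matrix (Fin m) (Fin m) ℝ :=
  pb.P.map (MvPolynomial.eval (Sum.elim y x))

/-- The feasible set. -/
def feasible : Set (Fin l → ℝ) := {y | y ∈ pb.Y ∧ ∀ x ∈ pb.X, (pb.PAt y x).PosSemidef}

/-- The optimal value `f*`. -/
def optVal : EReal := ⨅ y ∈ pb.feasible, ((MvPolynomial.eval y pb.f : ℝ) : EReal)

/-- `y` is an optimal solution. -/
def IsOptimal (y : Fin l → ℝ) : Prop :=
  y ∈ pb.feasible ∧ ((MvPolynomial.eval y pb.f : ℝ) : EReal) = pb.optVal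

/-- The convexity assumption: `f, -θ₁, …, -θ_s` are convex, `-P(·, x)` is PSD-convex for every
`x ∈ 𝒳`, and `𝒳` is compact. -/
structure IsConvex : Prop where
  f_convex : ConvexOn ℝ Set.univ fun y : Fin l → ℝ => MvPolynomial.eval y pb.f
  θ_convex : ∀ i, ConvexOn ℝ Set.univ fun y : Fin l → ℝ => -MvPolynomial.eval y (pb.θ i)
  P_convex : ∀ x ∈ pb.X, ∀ (y₁ y₂ : Fin l → ℝ) (t : ℝ), t ∈ Set.Ioo (0 : ℝ) 1 →
    ((t • (-pb.PAt y₁ x) + (1 - t) • (-pb.PAt y₂ x)) -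
      (-pb.PAt (t • y₁ + (1 - t) • y₂) x)).PosSemidef
  X_compact : IsCompact pb.X

/-- `Θ`, as the diagonal matrix `diag(θ₁, …, θ_s)`. -/
def Θ : PolyMat l (Fin s) := Matrix.diagonal pb.θ

/-- `k_y = max {deg f, deg θ_i, deg_y P_ij}`. -/
def ky : ℕ :=
  max pb.f.totalDegree (max ((Finset.univ : Finset (Fin s)).sup fun i => (pb.θ i).totalDegree)
    ((Finset.univ : Finset (Fin m × Fin m)).sup fun p => degY (pb.P p.1 p.2)))

/-- `k_x = max {deg_x P_ij, deg G}`. -/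
def kx : ℕ :=
  max ((Finset.univ : Finset (Fin m × Fin m)).sup fun p => degX (pb.P p.1 p.2)) pb.G.deg

/-- `ℒ_S(P(y, x)) = ∑_α tr(P_α(y) S_α) ∈ ℝ[y]`, where `P(y, x) = ∑_α P_α(y) x^α`. -/
def rieszX (S : MatSeq n m) : MvPolynomial (Fin l) ℝ :=
  ∑ i, ∑ j, ∑ γ ∈ (pb.P i j).support,
    MvPolynomial.monomial (yPart γ) ((pb.P i j).coeff γ * S (xPart γ) j i)

/-- `ℋ_s(P(y, x)) = ∑_β P_β(x) s_β ∈ 𝕊[x]ᵐ`, where `P(y, x) = ∑_β P_β(x) y^β`. -/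
def rieszY (s : (Fin l →₀ ℕ) → ℝ) : PolyMat n (Fin m) :=
  Matrix.of fun i j => ∑ γ ∈ (pb.P i j).support,
    MvPolynomial.monomial (xPart γ) ((pb.P i j).coeff γ * s (yPart γ))

/-- `(ρ, S)` is feasible for the primal relaxation of order `k`:
`f - ρ - ℒ_S(P) ∈ 𝒬_k(Θ)` and `S ∈ ℳᵐ_k(G)`. -/
def PrimalFeasible (k : ℕ) (ρ : ℝ) (S : MatSeq n m) : Prop :=
  (Matrix.of fun _ _ : Fin 1 => pb.f - MvPolynomial.C ρ - pb.rieszX S) ∈ truncQuadModule 1 pb.Θ k ∧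
    S ∈ momentCone k pb.G

/-- The optimal value of the primal relaxation. -/
def primalVal (k : ℕ) : EReal :=
  ⨆ (ρ : ℝ) (S : MatSeq n m) (_ : pb.PrimalFeasible k ρ S), (ρ : EReal)

/-- `(ρ, S)` is an optimal solution to the primal relaxation. -/
def IsPrimalOptimal (k : ℕ) (ρ : ℝ) (S : MatSeq n m) : Prop :=
  pb.PrimalFeasible k ρ S ∧ (ρ : EReal) = pb.primalVal k

/-- `s` is feasible for the dual relaxation of order `k`:
`s ∈ ℳ_k(Θ)`, `ℋ_s(1) = 1` and `ℋ_s(P) ∈ 𝒬ᵐ_k(G)`. -/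
def DualFeasible (k : ℕ) (s : (Fin l →₀ ℕ) → ℝ) : Prop :=
  scalarSeq s ∈ momentCone k pb.Θ ∧ rieszFun s 1 = 1 ∧ pb.rieszY s ∈ truncQuadModule m pb.G k

/-- The optimal value of the dual relaxation. -/
def dualVal (k : ℕ) : EReal :=
  ⨅ (s : (Fin l →₀ ℕ) → ℝ) (_ : pb.DualFeasible k s), (rieszFun s pb.f : EReal)

/-- `s` is an optimal solution to the dual relaxation. -/
def IsDualOptimal (k : ℕ) (s : (Fin l →₀ ℕ) → ℝ) : Prop :=
  pb.DualFeasible k s ∧ (rieszFun s pb.f : EReal) = pb.dualVal k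

/-- The flat extension condition for `S`, at level `t`. The step is `max {1, d_G}`, which is
`d_G` unless `G` is constant. -/
def PrimalFlat (k : ℕ) (S : MatSeq n m) (t : ℕ) : Prop :=
  ceilHalf pb.kx ≤ t ∧ t ≤ k ∧ FlatAt S (max 1 pb.G.halfDeg) t

/-- The flat extension condition for `s`, at level `t`. The step is `max {1, d_Θ}`, which is
`d_Θ` unless all `θ_i` are constant. -/
def DualFlat (k : ℕ) (s : (Fin l →₀ ℕ) → ℝ) (t : ℕ) : Prop :=
  ceilHalf pb.ky ≤ t ∧ t ≤ k ∧ FlatAt (scalarSeq s) (max 1 pb.Θ.halfDeg) t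

end Problem

end

end RobustPMI

/-! The analytic core is the flat extension theorem for matrix-valued sequences, proved by operator
theory. A PSD matrix `M_t(S)` is the Gram matrix of vectors `u_{α,i}`, `|α| ≤ t`, and flatness says
that those with `|α| ≤ t - d` already span their whole space `H`. As `d ≥ 1`, the shifts `u_{α,i} ↦
u_{α+e_c,i}` are well-defined operators on `H`. The Hankel structure `⟪u_{α,i}, u_{β,j}⟫ =
(S_{α+β})_{ij}` makes them symmetric and commuting, so they have a joint orthonormal eigenbasis
`b_k`. The joint eigenvalues `χ_k` are the atoms: with `p_k = (⟪b_k, u_{0,i}⟫)_i`, Parseval's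
identity gives `S_α = ∑ χ_k^α p_k p_kᵀ` (`exists_atoms_of_flatAt`). Each `b_k` is also a combination
of vectors of order at most `t - d`. Its coefficients form a test vector for the localizing matrix
which isolates `G(χ_k)` and shows that it is PSD (`atom_mem_psdSet`).

The bounds follow by evaluating at atoms. On the primal side `f - ρ - ℒ_S(P) ≥ 0` on `𝒴`, and
`ℒ_S(P)(y) = ∑ tr(P(y, x_i) W_i) ≥ 0` for feasible `y`, so `ρ ≤ f(y)`. On the dual side Jensen's
inequality makes the barycentre `ȳ` feasible, with `f(ȳ) ≤ ℋ_s(f)` (`IsConvex.sum_mem_feasible`). If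
the two values agree, then `ρ ≤ ρ + ∑ tr(P(ȳ, x_i) W_i) ≤ f(ȳ) ≤ ℋ_s(f) = ρ` collapses. So `ȳ` is
optimal, every trace vanishes, and for PSD matrices this forces `P(ȳ, x_i) v = 0`. -/

namespace RobustPMI

/-! ### Commuting symmetric operators and Gram matrices -/

/-- Finitely many commuting symmetric operators have a common orthonormal eigenbasis. -/
theorem exists_joint_eigenbasis {H : Type*} [NormedAddCommGroup H] [InnerProductSpace ℝ H]
    [FiniteDimensional ℝ H] {n : ℕ} (T : Fin n → Module.End ℝ H)
    (hT : ∀ c, (T c).IsSymmetric) (hC : Pairwise (Function.onFun Commute T)) :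
    ∃ (b : OrthonormalBasis (Fin (Module.finrank ℝ H)) ℝ H)
      (χ : Fin (Module.finrank ℝ H) → Fin n → ℝ), ∀ k c, T c (b k) = χ k c • b k := by
  classical
  let V : (Fin n → ℝ) → Submodule ℝ H := fun χ => ⨅ c, (T c).eigenspace (χ c)
  have hint : DirectSum.IsInternal V :=
    LinearMap.IsSymmetric.directSum_isInternal_of_pairwise_commute hT hC
  have horth : OrthogonalFamily ℝ (fun χ => V χ) fun χ => (V χ).subtypeₗᵢ :=
    LinearMap.IsSymmetric.orthogonalFamily_iInf_eigenspaces hT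
  have hfin : {χ | V χ ≠ ⊥}.Finite :=
    WellFoundedGT.finite_ne_bot_of_iSupIndep hint.submodule_iSupIndep
  have : Fintype {χ // V χ ≠ ⊥} := hfin.fintype
  have hint' : DirectSum.IsInternal fun χ : {χ // V χ ≠ ⊥} => V χ :=
    DirectSum.isInternal_ne_bot_iff.mpr hint
  have horth' : OrthogonalFamily ℝ (fun χ : {χ // V χ ≠ ⊥} => V χ)
      fun χ => (V χ).subtypeₗᵢ := horth.comp Subtype.val_injective
  refine ⟨hint'.subordinateOrthonormalBasis rfl horth',
    fun k => (hint'.subordinateOrthonormalBasisIndex rfl k horth').1, fun k c => ?_⟩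
  have h := hint'.subordinateOrthonormalBasis_subordinate rfl k horth'
  exact Module.End.mem_eigenspace_iff.mp ((Submodule.mem_iInf _).mp h c)

/-- The Gram matrix is `Bᵀ B` with the vectors as columns of `B`. This turns the rank condition of
flatness into an equality of spans. -/
theorem rank_gram_eq_finrank_span {ι : Type*} [Fintype ι] {N : ℕ}
    (w : ι → EuclideanSpace ℝ (Fin N)) :
    (Matrix.of fun i j => inner ℝ (w i) (w j)).rank =
      Module.finrank ℝ (Submodule.span ℝ (Set.range w)) := by
  let B : Matrix (Fin N) ι ℝ := Matrix.of fun k i => w i k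
  have h : (Matrix.of fun i j => inner ℝ (w i) (w j)) = B.transpose * B := by
    ext i j
    simp [B, Matrix.mul_apply, PiLp.inner_apply, mul_comm]
  rw [h, Matrix.rank_transpose_mul_self, Matrix.rank_eq_finrank_span_cols]
  have h2 : Set.range B.col = (WithLp.linearEquiv 2 ℝ (Fin N → ℝ)) '' Set.range w := by
    rw [← Set.range_comp]
    rfl
  rw [h2]
  have h3 := Submodule.map_span (WithLp.linearEquiv 2 ℝ (Fin N → ℝ)).toLinearMap (Set.range w)
  have h4 := LinearEquiv.finrank_map_eq (WithLp.linearEquiv 2 ℝ (Fin N → ℝ))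
    (Submodule.span ℝ (Set.range w))
  rw [← h4]
  exact congrArg (fun K : Submodule ℝ (Fin N → ℝ) => Module.finrank ℝ K) h3.symm

theorem exists_gram_vectors {ι : Type*} [Fintype ι] {M : Matrix ι ι ℝ} (hM : M.PosSemidef) :
    ∃ (N : ℕ) (w : ι → EuclideanSpace ℝ (Fin N)), M = Matrix.of fun i j => inner ℝ (w i) (w j) := by
  obtain ⟨N, v, hv⟩ := Matrix.posSemidef_iff_eq_sum_vecMulVec.mp hM
  refine ⟨N, fun i => WithLp.toLp 2 fun k => v k i, ?_⟩
  ext i j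
  rw [hv]
  simp [Matrix.sum_apply, Matrix.vecMulVec_apply, PiLp.inner_apply, mul_comm]

/-- Ensures that every moment of order at most `2t` occurs as a block of `M_t`. -/
theorem exists_add_eq_of_degree_le {n t : ℕ} (α : Fin n →₀ ℕ) (h : α.degree ≤ 2 * t) :
    ∃ β γ : Fin n →₀ ℕ, β.degree ≤ t ∧ γ.degree ≤ t ∧ β + γ = α := by
  rcases le_total α.degree t with h1 | h1
  · exact ⟨α, 0, h1, by simp, by simp⟩
  · obtain ⟨β, hβ, hd⟩ := Finsupp.exists_le_degree_eq α t h1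
    obtain ⟨γ, rfl⟩ := le_iff_exists_add.mp hβ
    rw [map_add] at h
    exact ⟨β, γ, by omega, by omega, rfl⟩

/-! ### Multiplication operators of a flat moment matrix -/

section Flat

variable {n m : ℕ} {H : Type*} [NormedAddCommGroup H] [InnerProductSpace ℝ H]

/-- The shift `u_α ↦ u_{α + e_c}` is a well-defined operator when the vectors of order at most `t`
span the space. -/
theorem exists_shift_operator (u : (Fin n →₀ ℕ) → Fin m → H) (S : MatSeq n m) (t : ℕ)
    (hu : ∀ α β : Fin n →₀ ℕ, α.degree ≤ t + 1 → β.degree ≤ t + 1 → ∀ i j,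
      inner ℝ (u α i) (u β j) = S (α + β) i j)
    (hspan : Submodule.span ℝ (Set.range fun p : MonIdx n t × Fin m => u p.1 p.2) = ⊤)
    (c : Fin n) :
    ∃ T : Module.End ℝ H, ∀ α : Fin n →₀ ℕ, α.degree ≤ t → ∀ i,
      T (u α i) = u (α + Finsupp.single c 1) i := by
  classical
  let L : ((MonIdx n t × Fin m) → ℝ) →ₗ[ℝ] H :=
    Fintype.linearCombination ℝ fun p => u p.1 p.2
  let L' : ((MonIdx n t × Fin m) → ℝ) →ₗ[ℝ] H :=
    Fintype.linearCombination ℝ fun p => u (p.1.1 + Finsupp.single c 1) p.2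
  have hL : L.range = ⊤ := by
    rw [Fintype.range_linearCombination, hspan]
  have hdeg : ∀ α : Fin n →₀ ℕ, α.degree ≤ t → (α + Finsupp.single c 1).degree ≤ t + 1 := by
    intro α h
    simpa using h
  -- By the Hankel structure a shift on the left of the inner product can be moved to the right.
  -- Hence `L a = 0` makes `L' a` orthogonal to a spanning family.
  have hker : ∀ a, L a = 0 → L' a = 0 := by
    intro a ha
    have horth : ∀ v ∈ Submodule.span ℝ (Set.range fun p : MonIdx n t × Fin m => u p.1 p.2),
        inner ℝ (L' a) v = 0 := by
      intro v hv
      induction hv using Submodule.span_induction with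
      | mem x hx =>
        obtain ⟨p, rfl⟩ := hx
        have h1 : inner ℝ (L' a) (u p.1 p.2) =
            inner ℝ (L a) (u (p.1.1 + Finsupp.single c 1) p.2) := by
          simp only [L, L', Fintype.linearCombination_apply, sum_inner, inner_smul_left]
          refine Finset.sum_congr rfl fun x _ => ?_
          rw [hu _ _ (hdeg _ x.1.2) (p.1.2.trans (Nat.le_succ t)),
            hu _ _ (x.1.2.trans (Nat.le_succ t)) (hdeg _ p.1.2)]
          congr 2
          rw [add_assoc, add_comm (Finsupp.single c 1)]
        rw [h1, ha, inner_zero_left]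
      | zero => simp
      | add x y _ _ hx hy => rw [inner_add_right, hx, hy, add_zero]
      | smul r x _ hx => rw [inner_smul_right, hx, mul_zero]
    exact inner_self_eq_zero.mp (horth _ (hspan ▸ Submodule.mem_top))
  -- Any section `g` of `L` serves: two preimages differ by an element of the kernel, which `L'`
  -- kills.
  obtain ⟨g, hg⟩ := LinearMap.exists_rightInverse_of_surjective L hL
  refine ⟨L' ∘ₗ g, fun α hα i => ?_⟩
  have h1 : L (Pi.single (⟨α, hα⟩, i) 1) = u α i := by
    simp [L, Fintype.linearCombination_apply_single]
  have h2 : L' (Pi.single (⟨α, hα⟩, i) 1) = u (α + Finsupp.single c 1) i := by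
    simp [L', Fintype.linearCombination_apply_single]
  rw [← h2, LinearMap.comp_apply, ← sub_eq_zero, ← map_sub]
  apply hker
  rw [map_sub, h1, sub_eq_zero]
  exact LinearMap.congr_fun hg (u α i)

/-- Equality of two bilinear forms `⟪A x, B y⟫` can be tested on a spanning family. -/
theorem bilin_ext_of_span {ι : Type*} {w : ι → H} (hspan : Submodule.span ℝ (Set.range w) = ⊤)
    (A B A' B' : Module.End ℝ H)
    (h : ∀ p q, inner ℝ (A (w p)) (B (w q)) = inner ℝ (A' (w p)) (B' (w q))) (x y : H) :
    inner ℝ (A x) (B y) = inner ℝ (A' x) (B' y) := by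
  have hx : x ∈ Submodule.span ℝ (Set.range w) := hspan ▸ Submodule.mem_top
  have hy : y ∈ Submodule.span ℝ (Set.range w) := hspan ▸ Submodule.mem_top
  induction hx using Submodule.span_induction with
  | mem x hx =>
    obtain ⟨p, rfl⟩ := hx
    induction hy using Submodule.span_induction with
    | mem y hy => obtain ⟨q, rfl⟩ := hy; exact h p q
    | zero => simp
    | add y z _ _ hy hz => simp only [map_add, inner_add_right, hy, hz]
    | smul r y _ hy => simp only [map_smul, inner_smul_right, hy]
  | zero => simp
  | add x z _ _ hx hz => simp only [map_add, inner_add_left, hx, hz]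
  | smul r x _ hx => simp only [map_smul, inner_smul_left, hx]

/-- Vectors realizing a moment sequence, spanned by those of lower order, have coordinates of
monomial form in a suitable orthonormal basis. -/
theorem exists_monomial_coordinates [FiniteDimensional ℝ H] (u : (Fin n →₀ ℕ) → Fin m → H)
    (S : MatSeq n m) (t : ℕ)
    (hu : ∀ α β : Fin n →₀ ℕ, α.degree ≤ t + 1 → β.degree ≤ t + 1 → ∀ i j,
      inner ℝ (u α i) (u β j) = S (α + β) i j)
    (hspan : Submodule.span ℝ (Set.range fun p : MonIdx n t × Fin m => u p.1 p.2) = ⊤) :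
    ∃ (b : OrthonormalBasis (Fin (Module.finrank ℝ H)) ℝ H)
      (χ : Fin (Module.finrank ℝ H) → Fin n → ℝ),
      ∀ k (α : Fin n →₀ ℕ), α.degree ≤ t + 1 → ∀ i,
        inner ℝ (b k) (u α i) = (∏ c, χ k c ^ α c) * inner ℝ (b k) (u 0 i) := by
  choose T hT using exists_shift_operator u S t hu hspan
  have hdeg : ∀ c (α : Fin n →₀ ℕ), α.degree ≤ t → (α + Finsupp.single c 1).degree ≤ t + 1 := by
    intro c α h
    simpa using h
  have hsymm : ∀ c, (T c).IsSymmetric := by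
    intro c x y
    refine bilin_ext_of_span hspan (T c) 1 1 (T c) (fun p q => ?_) x y
    simp only [Module.End.one_apply]
    rw [hT c _ p.1.2, hT c _ q.1.2, hu _ _ (hdeg c _ p.1.2) (q.1.2.trans (Nat.le_succ t)),
      hu _ _ (p.1.2.trans (Nat.le_succ t)) (hdeg c _ q.1.2)]
    congr 1
    rw [add_assoc, add_comm (Finsupp.single c 1)]
  have hcomm : Pairwise (Function.onFun Commute T) := by
    intro c d _
    refine LinearMap.ext fun x => ext_inner_right ℝ fun y => ?_
    -- Symmetry puts one shift on each side, since a double shift could leave the range of orders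
    -- where `hu` applies.
    rw [Module.End.mul_apply, Module.End.mul_apply, hsymm c (T d x), hsymm d (T c x)]
    refine bilin_ext_of_span hspan (T d) (T c) (T c) (T d) (fun p q => ?_) x y
    rw [hT c _ p.1.2, hT c _ q.1.2, hT d _ p.1.2, hT d _ q.1.2,
      hu _ _ (hdeg d _ p.1.2) (hdeg c _ q.1.2), hu _ _ (hdeg c _ p.1.2) (hdeg d _ q.1.2)]
    congr 1
    abel
  obtain ⟨b, χ, hb⟩ := exists_joint_eigenbasis T hsymm hcomm
  have key : ∀ (N : ℕ) k (α : Fin n →₀ ℕ), α.degree = N → N ≤ t + 1 → ∀ i,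
      inner ℝ (b k) (u α i) = (∏ c, χ k c ^ α c) * inner ℝ (b k) (u 0 i) := by
    intro N
    induction N with
    | zero =>
      intro k α hα _ i
      obtain rfl := (Finsupp.degree_eq_zero_iff α).mp hα
      simp
    | succ N ih =>
      intro k α hα hN i
      have hne : α.support.Nonempty := by
        rw [Finset.nonempty_iff_ne_empty, Ne, Finsupp.support_eq_empty]
        rintro rfl
        simp at hα
      obtain ⟨c, hc⟩ := hne
      have hc' : Finsupp.single c 1 ≤ α :=
        Finsupp.single_le_iff.mpr (Nat.one_le_iff_ne_zero.mpr (Finsupp.mem_support_iff.mp hc))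
      obtain ⟨β, rfl⟩ := le_iff_exists_add'.mp hc'
      have hβ : β.degree = N := by simpa using hα
      -- One unit of the exponent is written as `T c`, which moves onto its eigenvector `b k` and
      -- becomes the factor `χ k c`.
      rw [← hT c β (by omega), ← hsymm c, hb, inner_smul_left, ih k β hβ (by omega)]
      have hp : ∏ e, χ k e ^ (β + Finsupp.single c 1 : Fin n →₀ ℕ) e = χ k c * ∏ e, χ k e ^ β e := by
        simp only [Finsupp.add_apply, pow_add, Finset.prod_mul_distrib, mul_comm (χ k c)]
        congr 1
        rw [Finset.prod_eq_single c (fun e _ he => by simp [Finsupp.single_eq_of_ne he]) (by simp)]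
        simp
      rw [hp]
      simp [mul_assoc]
  exact ⟨b, χ, fun k α hα i => key _ k α rfl hα i⟩

end Flat

/-- The dual-basis form of the flat extension theorem: atoms `χ k` with rank-one weights
`p k (p k)ᵀ`, together with polynomial vectors `a k` of degree at most `t - d` that
separate them. -/
theorem exists_atoms_of_flatAt {n m d t : ℕ} {S : MatSeq n m}
    (hM : (momentMatrix t S).PosSemidef) (hd : 1 ≤ d) (hflat : FlatAt S d t) :
    ∃ (K : ℕ) (χ : Fin K → Fin n → ℝ) (p : Fin K → Fin m → ℝ)
      (a : Fin K → MonIdx n (t - d) × Fin m → ℝ),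
      (∀ α : Fin n →₀ ℕ, α.degree ≤ 2 * t → ∀ i j,
        S α i j = ∑ k, (∏ c, χ k c ^ α c) * (p k i * p k j)) ∧
      ∀ k l, ∑ e, a k e * ((∏ c, χ l c ^ (e.1 : Fin n →₀ ℕ) c) * p l e.2) =
        if l = k then 1 else 0 := by
  classical
  obtain ⟨hdt, hrank⟩ := hflat
  obtain ⟨N, w, hw⟩ := exists_gram_vectors hM
  let lift (r : ℕ) (hr : r ≤ t) (e : MonIdx n r × Fin m) : MonIdx n t × Fin m :=
    (⟨e.1.1, e.1.2.trans hr⟩, e.2)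
  let H := Submodule.span ℝ (Set.range w)
  have hsub : t - d ≤ t := Nat.sub_le _ _
  have hM' : momentMatrix (t - d) S = Matrix.of fun i j =>
      inner ℝ (w (lift _ hsub i)) (w (lift _ hsub j)) := by
    ext i j
    exact congrFun (congrFun hw (lift _ hsub i)) (lift _ hsub j)
  have hle : ∀ r (hr : r ≤ t), Submodule.span ℝ (Set.range fun e => w (lift r hr e)) ≤ H :=
    fun r hr => Submodule.span_mono (by rintro _ ⟨e, rfl⟩; exact ⟨_, rfl⟩)
  have heq : Submodule.span ℝ (Set.range fun e => w (lift _ hsub e)) = H := by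
    refine Submodule.eq_of_le_of_finrank_eq (hle _ hsub) ?_
    rw [← rank_gram_eq_finrank_span, ← rank_gram_eq_finrank_span, ← hM', ← hw, hrank]
  -- The Gram vectors stop at order `t`; the value `0` beyond it is never used.
  let u : (Fin n →₀ ℕ) → Fin m → H := fun α i =>
    if h : α.degree ≤ t then ⟨w (⟨α, h⟩, i), Submodule.subset_span ⟨_, rfl⟩⟩ else 0
  have hu_coe : ∀ α (h : α.degree ≤ t) i, (u α i : EuclideanSpace ℝ (Fin N)) = w (⟨α, h⟩, i) := by
    intro α h i
    simp only [u, dif_pos h]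
  have hu : ∀ α β : Fin n →₀ ℕ, α.degree ≤ t → β.degree ≤ t → ∀ i j,
      inner ℝ (u α i) (u β j) = S (α + β) i j := by
    intro α β hα hβ i j
    rw [Submodule.coe_inner, hu_coe α hα, hu_coe β hβ]
    exact (congrFun (congrFun hw (⟨α, hα⟩, i)) (⟨β, hβ⟩, j)).symm
  have hspan : ∀ r (hr : r ≤ t), Submodule.span ℝ (Set.range fun e => w (lift r hr e)) = H →
      Submodule.span ℝ (Set.range fun e : MonIdx n r × Fin m => u e.1 e.2) = ⊤ := by
    intro r hr h
    apply Submodule.map_injective_of_injective H.injective_subtype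
    rw [Submodule.map_span, Submodule.map_top, Submodule.range_subtype, ← Set.range_comp]
    refine Eq.trans ?_ h
    congr 2
    funext e
    exact hu_coe _ (e.1.2.trans hr) _
  -- Here `1 ≤ d` enters: order `t - d` lies within order `t - 1`, which leaves room for one shift.
  have hspan1 : Submodule.span ℝ
      (Set.range fun e : MonIdx n (t - 1) × Fin m => u e.1 e.2) = ⊤ := by
    refine hspan _ (Nat.sub_le _ _) (le_antisymm (hle _ (Nat.sub_le _ _)) ?_)
    rw [← heq]
    apply Submodule.span_mono
    rintro _ ⟨e, rfl⟩
    exact ⟨(⟨e.1.1, e.1.2.trans (by omega)⟩, e.2), rfl⟩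
  have ht : t - 1 + 1 = t := by omega
  obtain ⟨b, χ, hχ⟩ := exists_monomial_coordinates u S (t - 1) (by rwa [ht]) hspan1
  rw [ht] at hχ
  have hmem : ∀ k, ∃ a : MonIdx n (t - d) × Fin m → ℝ, ∑ e, a e • u e.1 e.2 = b k := by
    intro k
    have : b k ∈ Submodule.span ℝ
        (Set.range fun e : MonIdx n (t - d) × Fin m => u e.1 e.2) := by
      rw [hspan _ hsub heq]
      exact Submodule.mem_top
    exact (Submodule.mem_span_range_iff_exists_fun ℝ).mp this
  choose a ha using hmem
  refine ⟨_, χ, fun k i => inner ℝ (b k) (u 0 i), a, ?_, ?_⟩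
  · intro α hα i j
    obtain ⟨β, γ, hβ, hγ, rfl⟩ := exists_add_eq_of_degree_le α hα
    rw [← hu β γ hβ hγ, ← b.sum_inner_mul_inner]
    refine Finset.sum_congr rfl fun k _ => ?_
    rw [real_inner_comm, hχ k β hβ, hχ k γ hγ]
    simp only [Finsupp.add_apply, pow_add, Finset.prod_mul_distrib]
    ring
  · intro k l
    have h1 : ∑ e, a k e * ((∏ c, χ l c ^ (e.1 : Fin n →₀ ℕ) c) * inner ℝ (b l) (u 0 e.2)) =
        inner ℝ (b l) (b k) := by
      rw [← ha k, inner_sum]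
      refine Finset.sum_congr rfl fun e _ => ?_
      rw [← hχ l _ (e.1.2.trans hsub)]
      exact (real_inner_smul_right _ _ _).symm
    rw [h1, orthonormal_iff_ite.mp b.orthonormal]

/-! ### Atoms lie in the semialgebraic set -/

theorem PolyMat.totalDegree_le_two_mul_halfDeg {n q : ℕ} (G : PolyMat n (Fin q)) (a b : Fin q) :
    (G a b).totalDegree ≤ 2 * G.halfDeg := by
  have h : (G a b).totalDegree ≤ G.deg :=
    Finset.le_sup (f := fun p : Fin q × Fin q => (G p.1 p.2).totalDegree) (Finset.mem_univ (a, b))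
  unfold PolyMat.halfDeg ceilHalf
  omega

theorem degree_le_totalDegree {σ : Type*} {p : MvPolynomial σ ℝ} {γ : σ →₀ ℕ}
    (h : γ ∈ p.support) : γ.degree ≤ p.totalDegree :=
  MvPolynomial.le_totalDegree h

theorem sum_prod_assoc {A B C : Type*} [Fintype A] [Fintype B] [Fintype C] (F : A × B → C → ℝ) :
    ∑ p : A × (B × C), F (p.1, p.2.1) p.2.2 = ∑ x, ∑ c, F x c := by
  simp only [Fintype.sum_prod_type]

/-- The contribution of a single atom to the localizing form at a product test vector: the scalar
part splits off as a square. -/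
theorem quadForm_tensor {A C : Type*} [Fintype A] [Fintype C] (f : A → ℝ) (ξ : C → ℝ)
    (g : C → C → ℝ) :
    ∑ x, ∑ a, ∑ y, ∑ b, (f x * ξ a) * (f y * ξ b * g a b) =
      (∑ x, f x) ^ 2 * ∑ a, ∑ b, ξ a * (ξ b * g a b) := by
  have h : ∀ x, ∑ a, ∑ y, ∑ b, (f x * ξ a) * (f y * ξ b * g a b) =
      ∑ y, f x * f y * ∑ a, ∑ b, ξ a * (ξ b * g a b) := by
    intro x
    rw [Finset.sum_comm]
    refine Finset.sum_congr rfl fun y _ => ?_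
    simp only [Finset.mul_sum]
    refine Finset.sum_congr rfl fun a _ => Finset.sum_congr rfl fun b _ => ?_
    ring
  rw [Finset.sum_congr rfl fun x _ => h x, sq, Finset.sum_mul_sum, Finset.sum_mul]
  exact Finset.sum_congr rfl fun x _ => (Finset.sum_mul _ _ _).symm

theorem PolyMat.IsSymm.evalAt_isHermitian {n : ℕ} {ι : Type} {G : PolyMat n ι} (hG : G.IsSymm)
    (x : Fin n → ℝ) : (G.evalAt x).IsHermitian := by
  ext i j
  simp [PolyMat.evalAt, hG.apply i j]

/-- The localizing form is a sum over the atoms. The test vector `a k ⊗ ξ` annihilates every term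
but that of `χ k`, by the biorthogonality `ha`, and leaves `ξᵀ G(χ k) ξ`. -/
theorem atom_mem_psdSet {n m q d t e K : ℕ} {S : MatSeq n m} {G : PolyMat n (Fin q)}
    (hG : G.IsSymm) (hloc : (localizingMatrix e G S).PosSemidef) (hte : t - d ≤ e) (hdt : d ≤ t)
    (hd : G.halfDeg ≤ d) {χ : Fin K → Fin n → ℝ} {p : Fin K → Fin m → ℝ}
    {a : Fin K → MonIdx n (t - d) × Fin m → ℝ}
    (hS : ∀ α : Fin n →₀ ℕ, α.degree ≤ 2 * t → ∀ i j,
        S α i j = ∑ k, (∏ c, χ k c ^ α c) * (p k i * p k j))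
    (ha : ∀ k l, ∑ e, a k e * ((∏ c, χ l c ^ (e.1 : Fin n →₀ ℕ) c) * p l e.2) =
        if l = k then 1 else 0) (k : Fin K) : χ k ∈ psdSet G := by
  classical
  let lift : MonIdx n (t - d) × (Fin m × Fin q) → MonIdx n e × (Fin m × Fin q) :=
    fun x => (⟨x.1.1, x.1.2.trans hte⟩, x.2)
  have hloc' : (localizingMatrix (t - d) G S).PosSemidef := hloc.submatrix lift
  refine Matrix.PosSemidef.of_dotProduct_mulVec_nonneg
    (PolyMat.IsSymm.evalAt_isHermitian hG _) fun ξ => ?_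
  let z : Fin K → MonIdx n (t - d) × Fin m → ℝ :=
    fun l x => (∏ c, χ l c ^ (x.1 : Fin n →₀ ℕ) c) * p l x.2
  have hentry : ∀ x y, localizingMatrix (t - d) G S x y =
      ∑ l, z l (x.1, x.2.1) * z l (y.1, y.2.1) * (G.evalAt (χ l)) x.2.2 y.2.2 := by
    intro x y
    simp only [localizingMatrix, Matrix.of_apply, PolyMat.evalAt, Matrix.map_apply,
      MvPolynomial.eval_eq', Finset.mul_sum]
    rw [Finset.sum_comm]
    refine Finset.sum_congr rfl fun γ hγ => ?_
    have hγd := (degree_le_totalDegree hγ).trans (G.totalDegree_le_two_mul_halfDeg _ _)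
    have hx := x.1.2
    have hy := y.1.2
    -- The order is at most `2(t - d) + 2 d_G ≤ 2t`, because `d_G ≤ d ≤ t`.
    rw [hS _ (by rw [map_add, map_add]; omega), Finset.sum_mul]
    refine Finset.sum_congr rfl fun l _ => ?_
    simp only [z, Finsupp.add_apply, pow_add, Finset.prod_mul_distrib]
    ring
  have h0 := hloc'.dotProduct_mulVec_nonneg fun x => a k (x.1, x.2.1) * ξ x.2.2
  have h1 : ∀ l, ∑ x : MonIdx n (t - d) × (Fin m × Fin q),
      ∑ y : MonIdx n (t - d) × (Fin m × Fin q),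
      (a k (x.1, x.2.1) * ξ x.2.2) * ((z l (x.1, x.2.1) * z l (y.1, y.2.1) *
        (G.evalAt (χ l)) x.2.2 y.2.2) * (a k (y.1, y.2.1) * ξ y.2.2)) =
      (if l = k then 1 else 0) ^ 2 *
        ∑ b, ∑ b', ξ b * (ξ b' * (G.evalAt (χ l)) b b') := by
    intro l
    rw [← ha k l]
    refine Eq.trans ?_ (quadForm_tensor (fun x => a k x * z l x) ξ
      fun b b' => (G.evalAt (χ l)) b b')
    refine Eq.trans ?_ (sum_prod_assoc _)
    refine Finset.sum_congr rfl fun x _ => ?_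
    refine Eq.trans ?_ (sum_prod_assoc _)
    exact Finset.sum_congr rfl fun y _ => by ring
  have h2 : star (fun x : MonIdx n (t - d) × (Fin m × Fin q) => a k (x.1, x.2.1) * ξ x.2.2) ⬝ᵥ
      (localizingMatrix (t - d) G S).mulVec (fun x => a k (x.1, x.2.1) * ξ x.2.2) =
      ∑ b, ∑ b', ξ b * (ξ b' * (G.evalAt (χ k)) b b') := by
    simp only [dotProduct, Matrix.mulVec, star_trivial, hentry, Finset.sum_mul, Finset.mul_sum]
    have h3 := Finset.sum_congr (rfl : (Finset.univ : Finset (Fin K)) = Finset.univ)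
      fun l _ => h1 l
    simp only [ite_pow, one_pow, ne_eq, OfNat.ofNat_ne_zero, not_false_eq_true, zero_pow,
      ite_mul, one_mul, zero_mul, Finset.sum_ite_eq', Finset.mem_univ, if_true] at h3
    rw [← h3]
    refine Eq.trans ?_ Finset.sum_comm
    refine Finset.sum_congr rfl fun x _ => ?_
    rw [Finset.sum_comm]
  rw [h2] at h0
  refine h0.trans_eq ?_
  simp only [dotProduct, Matrix.mulVec, star_trivial, Finset.mul_sum]
  exact Finset.sum_congr rfl fun b _ => Finset.sum_congr rfl fun b' _ => by ring

/-! ### Finitely atomic measures -/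

theorem integrable_dirac_vectorMeasure {n : ℕ} (x : Fin n → ℝ) (v : ℝ) (f : (Fin n → ℝ) → ℝ) :
    (VectorMeasure.dirac x v).Integrable f := by
  rw [VectorMeasure.Integrable, VectorMeasure.variation_dirac]
  exact (integrable_dirac (by simp)).smul_measure (by simp)

theorem atomicMatMeasure_apply {n m r : ℕ} (W : Fin r → Matrix (Fin m) (Fin m) ℝ)
    (x : Fin r → Fin n → ℝ) {A : Set (Fin n → ℝ)} (hA : MeasurableSet A) [DecidablePred (· ∈ A)] :
    (atomicMatMeasure W x).apply A = ∑ i, if x i ∈ A then W i else 0 := by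
  ext a b
  simp only [MatMeasure.apply, atomicMatMeasure, Matrix.of_apply, Matrix.sum_apply,
    FunLike.coe_sum, Finset.sum_apply]
  refine Finset.sum_congr rfl fun i _ => ?_
  split_ifs with h
  · rw [VectorMeasure.dirac_apply_of_mem hA h]
  · rw [VectorMeasure.dirac_apply_of_notMem h, Matrix.zero_apply]

theorem atomicMatMeasure_isPSDOn {n m r : ℕ} {W : Fin r → Matrix (Fin m) (Fin m) ℝ}
    {x : Fin r → Fin n → ℝ} {X : Set (Fin n → ℝ)} (hW : ∀ i, (W i).PosSemidef)
    (hx : ∀ i, x i ∈ X) : (atomicMatMeasure W x).IsPSDOn X := by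
  classical
  refine ⟨fun A hA => ?_, fun A hA hAX => ?_⟩
  · rw [atomicMatMeasure_apply W x hA]
    refine Matrix.posSemidef_sum _ fun i _ => ?_
    split_ifs
    · exact hW i
    · exact Matrix.PosSemidef.zero
  · rw [atomicMatMeasure_apply W x hA]
    exact Finset.sum_eq_zero fun i _ => if_neg fun h => Set.disjoint_left.mp hAX h (hx i)

theorem atomicMatMeasure_represents_iff {n m r : ℕ} {W : Fin r → Matrix (Fin m) (Fin m) ℝ}
    {x : Fin r → Fin n → ℝ} {S : MatSeq n m} {D : ℕ} :
    (atomicMatMeasure W x).Represents S D ↔ ∀ α : Fin n →₀ ℕ, α.degree ≤ D → ∀ a b,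
      S α a b = ∑ i, (∏ c, x i c ^ α c) * W i a b := by
  have hint : ∀ (a b : Fin m) (f : (Fin n → ℝ) → ℝ),
      (∑ i, VectorMeasure.dirac (x i) (W i a b)).Integrable f := fun a b f =>
    VectorMeasure.Integrable.finsetSum_vectorMeasure fun i _ =>
      integrable_dirac_vectorMeasure _ _ _
  have hval : ∀ (a b : Fin m) (f : (Fin n → ℝ) → ℝ),
      ∫ᵛ v, f v ∂•(∑ i, VectorMeasure.dirac (x i) (W i a b)) = ∑ i, f (x i) * W i a b := by
    intro a b f
    rw [VectorMeasure.integral_finsetSum_vectorMeasure fun i _ =>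
      integrable_dirac_vectorMeasure _ _ _]
    refine Finset.sum_congr rfl fun i _ => ?_
    rw [VectorMeasure.integral_dirac]
    rfl
  unfold MatMeasure.Represents
  simp only [atomicMatMeasure, Matrix.of_apply, hval, hint, true_and]

/-- For finitely many atoms in `X` with PSD weights, positivity, support and integrability are
automatic; only finite moment sums remain. -/
theorem isAtomicMatRep_iff {n m r : ℕ} {X : Set (Fin n → ℝ)} {S : MatSeq n m} {D : ℕ}
    {W : Fin r → Matrix (Fin m) (Fin m) ℝ} {x : Fin r → Fin n → ℝ} :
    IsAtomicMatRep X S D W x ↔ (∀ i, (W i).PosSemidef) ∧ Function.Injective x ∧ (∀ i, x i ∈ X) ∧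
      ∀ α : Fin n →₀ ℕ, α.degree ≤ D → ∀ a b, S α a b = ∑ i, (∏ c, x i c ^ α c) * W i a b := by
  unfold IsAtomicMatRep
  rw [atomicMatMeasure_represents_iff]
  constructor
  · rintro ⟨h1, h2, h3, -, h5⟩
    exact ⟨h1, h2, h3, h5⟩
  · rintro ⟨h1, h2, h3, h5⟩
    exact ⟨h1, h2, h3, atomicMatMeasure_isPSDOn h1 h3, h5⟩

theorem integrable_atomicMeasure {l r : ℕ} (w : Fin r → ℝ) (y : Fin r → Fin l → ℝ)
    (f : (Fin l → ℝ) → ℝ) : Integrable f (atomicMeasure w y) :=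
  integrable_finsetSum_measure.mpr fun _ _ =>
    (integrable_dirac (by simp)).smul_measure ENNReal.ofReal_ne_top

theorem integral_atomicMeasure {l r : ℕ} {w : Fin r → ℝ} (hw : ∀ j, 0 ≤ w j)
    (y : Fin r → Fin l → ℝ) (f : (Fin l → ℝ) → ℝ) :
    ∫ v, f v ∂(atomicMeasure w y) = ∑ j, w j * f (y j) := by
  rw [atomicMeasure, integral_finsetSum_measure fun j _ =>
    (integrable_dirac (by simp)).smul_measure ENNReal.ofReal_ne_top]
  refine Finset.sum_congr rfl fun j _ => ?_
  rw [integral_smul_measure, integral_dirac, ENNReal.toReal_ofReal (hw j), smul_eq_mul]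

theorem isAtomicProbRep_iff {l r : ℕ} {Y : Set (Fin l → ℝ)} {s : (Fin l →₀ ℕ) → ℝ} {D : ℕ}
    {w : Fin r → ℝ} {y : Fin r → Fin l → ℝ} (hY : MeasurableSet Y) :
    IsAtomicProbRep Y s D w y ↔ (∀ j, 0 < w j) ∧ Function.Injective y ∧ (∀ j, y j ∈ Y) ∧
      ∑ j, w j = 1 ∧
      ∀ α : Fin l →₀ ℕ, α.degree ≤ D → s α = ∑ j, w j * ∏ c, y j c ^ α c := by
  unfold IsAtomicProbRep
  refine and_congr_right fun hw => and_congr_right fun _ => and_congr_right fun hy => ?_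
  have hprob : IsProbabilityMeasure (atomicMeasure w y) ↔ ∑ j, w j = 1 := by
    rw [isProbabilityMeasure_iff]
    have : atomicMeasure w y Set.univ = ENNReal.ofReal (∑ j, w j) := by
      rw [ENNReal.ofReal_sum_of_nonneg fun j _ => (hw j).le]
      simp [atomicMeasure]
    rw [this, ENNReal.ofReal_eq_one]
  have hnull : atomicMeasure w y Yᶜ = 0 := by
    simp [atomicMeasure, Measure.dirac_apply' _ hY.compl, hy]
  rw [hprob]
  simp only [hnull, integrable_atomicMeasure, integral_atomicMeasure fun j => (hw j).le, true_and]

/-! ### The flat extension theorem -/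

/-- Several eigenvectors may share a joint eigenvalue. Summing `p pᵀ` over each fibre of `χ` makes
the points distinct, at the price of weights of higher rank. -/
theorem exists_atomicMatRep_of_flatAt {n m q d t k : ℕ} {S : MatSeq n m} {G : PolyMat n (Fin q)}
    (hG : G.IsSymm) (hS : S ∈ momentCone k G) (htk : t ≤ k) (hd : d = max 1 G.halfDeg)
    (hflat : FlatAt S d t) :
    ∃ (r : ℕ) (W : Fin r → Matrix (Fin m) (Fin m) ℝ) (x : Fin r → Fin n → ℝ),
      IsAtomicMatRep (psdSet G) S (2 * t) W x := by
  classical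
  obtain ⟨-, hM, hloc⟩ := hS
  let lift : MonIdx n t × Fin m → MonIdx n k × Fin m := fun e => (⟨e.1.1, e.1.2.trans htk⟩, e.2)
  have hMt : (momentMatrix t S).PosSemidef := hM.submatrix lift
  obtain ⟨K, χ, p, a, hSα, ha⟩ := exists_atoms_of_flatAt hMt (by omega) hflat
  have hχ := atom_mem_psdSet hG hloc (by have := hflat.1; omega) hflat.1 (by omega) hSα ha
  let X := Finset.univ.image χ
  let e : Fin X.card ≃ X := X.equivFin.symm
  refine ⟨X.card, fun i => ∑ l with χ l = e i, Matrix.vecMulVec (p l) (p l), fun i => e i,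
    isAtomicMatRep_iff.mpr ⟨fun i => ?_, ?_, fun i => ?_, fun α hα i j => ?_⟩⟩
  · exact Matrix.posSemidef_sum _ fun l _ => by
      simpa using Matrix.posSemidef_vecMulVec_self_star (p l)
  · exact Subtype.val_injective.comp e.injective
  · obtain ⟨l, -, hl⟩ := Finset.mem_image.mp (e i).2
    rw [← hl]
    exact hχ l
  · rw [hSα α hα, ← Finset.sum_fiberwise_of_maps_to (t := X) (g := χ)
      fun l _ => Finset.mem_image_of_mem χ (Finset.mem_univ l), ← Finset.sum_coe_sort X,
      ← e.sum_comp]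
    refine Finset.sum_congr rfl fun b _ => ?_
    rw [Matrix.sum_apply, Finset.mul_sum]
    refine Finset.sum_congr rfl fun l hl => ?_
    rw [(Finset.mem_filter.mp hl).2, Matrix.vecMulVec_apply]

/-! ### Evaluation of quadratic modules -/

theorem PolyMat.IsSOS.exists_evalAt {n : ℕ} {ι : Type} {F : PolyMat n ι} (hF : F.IsSOS)
    (x : Fin n → ℝ) :
    ∃ (l : ℕ) (T : Matrix (Fin l) ι ℝ), F.evalAt x = T.transpose * T := by
  obtain ⟨l, T, rfl⟩ := hF
  refine ⟨l, T.map (MvPolynomial.eval x), ?_⟩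
  ext i j
  simp [PolyMat.evalAt, Matrix.mul_apply]

theorem blockPairing_evalAt {n m q : ℕ} (A : PolyMat n (Fin m × Fin q)) (B : PolyMat n (Fin q))
    (x : Fin n → ℝ) (j k : Fin m) :
    (blockPairing A B).evalAt x j k =
      ∑ a, ∑ b, A.evalAt x (k, b) (j, a) * B.evalAt x b a := by
  simp only [PolyMat.evalAt, blockPairing, partialTrace, Matrix.map_apply, Matrix.of_apply,
    Matrix.mul_apply, Fintype.sum_prod_type, Matrix.kroneckerMap_apply, Matrix.transpose_apply,
    Matrix.one_apply, map_sum, map_mul]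
  refine Finset.sum_congr rfl fun a _ => ?_
  -- The factor `I_m` leaves only the block in column `k`.
  rw [Finset.sum_eq_single k]
  · simp
  · intro i _ hi
    simp [hi]
  · simp

/-- If `Σ₁(x) = Tᵀ T` and row `c` of `T` is reshaped to an `m × q` matrix `U_c`, then `(Σ₁, G)_m(x)
= ∑ U_c G(x)ᵀ U_cᵀ`, a sum of congruences of a PSD matrix. -/
theorem posSemidef_of_mem_truncQuadModule {n m q k : ℕ} {G : PolyMat n (Fin q)}
    {F : PolyMat n (Fin m)} (hF : F ∈ truncQuadModule m G k) {x : Fin n → ℝ}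
    (hx : x ∈ psdSet G) : (F.evalAt x).PosSemidef := by
  obtain ⟨S₀, S₁, h0, h1, -, -, rfl⟩ := hF
  have hadd : (S₀ + blockPairing S₁ G : PolyMat n (Fin m)).evalAt x =
      S₀.evalAt x + (blockPairing S₁ G).evalAt x := by
    ext i j
    simp [PolyMat.evalAt]
  rw [hadd]
  refine Matrix.PosSemidef.add ?_ ?_
  · obtain ⟨l, T, hT⟩ := h0.exists_evalAt x
    rw [hT]
    simpa using Matrix.posSemidef_conjTranspose_mul_self T
  · obtain ⟨l, T, hT⟩ := h1.exists_evalAt x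
    let U : Fin l → Matrix (Fin m) (Fin q) ℝ := fun c => Matrix.of fun j a => T c (j, a)
    have h : (blockPairing S₁ G).evalAt x =
        ∑ c, U c * (G.evalAt x).transpose * (U c).conjTranspose := by
      ext j k
      rw [blockPairing_evalAt, hT, Matrix.sum_apply]
      simp only [Matrix.mul_apply, Matrix.transpose_apply, Matrix.conjTranspose_apply, U,
        Matrix.of_apply, star_trivial, Finset.sum_mul]
      rw [Finset.sum_comm]
      conv_lhs => enter [2, b]; rw [Finset.sum_comm]
      rw [Finset.sum_comm]
      exact Finset.sum_congr rfl fun c _ => Finset.sum_congr rfl fun b _ =>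
        Finset.sum_congr rfl fun a _ => by ring
    rw [h]
    exact Matrix.posSemidef_sum _ fun c _ => hx.transpose.mul_mul_conjTranspose_same (U c)

theorem trace_mul_vecMulVec_sum {ι κ : Type*} [Fintype ι] [Fintype κ] (A : Matrix ι ι ℝ)
    (v : κ → ι → ℝ) :
    (A * ∑ a, Matrix.vecMulVec (v a) (v a)).trace = ∑ a, v a ⬝ᵥ A.mulVec (v a) := by
  rw [Matrix.mul_sum, Matrix.trace_sum]
  refine Finset.sum_congr rfl fun a _ => ?_
  rw [Matrix.mul_vecMulVec, Matrix.trace_vecMulVec, dotProduct_comm]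

theorem trace_mul_nonneg_of_posSemidef {ι : Type*} [Fintype ι] {A W : Matrix ι ι ℝ}
    (hA : A.PosSemidef) (hW : W.PosSemidef) : 0 ≤ (A * W).trace := by
  obtain ⟨N, v, rfl⟩ := Matrix.posSemidef_iff_eq_sum_vecMulVec.mp hW
  simp only [star_trivial]
  rw [trace_mul_vecMulVec_sum]
  exact Finset.sum_nonneg fun a _ => by simpa using hA.dotProduct_mulVec_nonneg (v a)

namespace Problem

variable {l n m q s : ℕ} (pb : Problem l n m q s)

/-! ### Evaluation of the Riesz functionals on atomic measures -/

theorem eval_sumElim (y : Fin l → ℝ) (x : Fin n → ℝ) (p : PolyYX l n) :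
    MvPolynomial.eval (Sum.elim y x) p = ∑ γ ∈ p.support,
      p.coeff γ * ((∏ c, y c ^ yPart γ c) * ∏ c, x c ^ xPart γ c) := by
  rw [MvPolynomial.eval_eq']
  refine Finset.sum_congr rfl fun γ _ => ?_
  rw [Fintype.prod_sum_type]
  rfl

theorem eval_monomial' {n : ℕ} (x : Fin n → ℝ) (α : Fin n →₀ ℕ) (a : ℝ) :
    MvPolynomial.eval x (MvPolynomial.monomial α a) = a * ∏ c, x c ^ α c := by
  rw [MvPolynomial.eval_monomial, Finsupp.prod_fintype _ _ (by simp)]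

theorem le_two_mul_ceilHalf (d : ℕ) : d ≤ 2 * ceilHalf d := by
  unfold ceilHalf
  omega

theorem xPart_degree_le (i j : Fin m) {γ : Fin l ⊕ Fin n →₀ ℕ} (hγ : γ ∈ (pb.P i j).support) :
    (xPart γ).degree ≤ pb.kx :=
  ((Finset.le_sup (f := fun γ => (xPart γ).degree) hγ).trans
    (Finset.le_sup (f := fun p : Fin m × Fin m => degX (pb.P p.1 p.2))
      (Finset.mem_univ (i, j)))).trans (le_max_left _ _)

theorem yPart_degree_le (i j : Fin m) {γ : Fin l ⊕ Fin n →₀ ℕ} (hγ : γ ∈ (pb.P i j).support) :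
    (yPart γ).degree ≤ pb.ky :=
  ((Finset.le_sup (f := fun γ => (yPart γ).degree) hγ).trans
    (Finset.le_sup (f := fun p : Fin m × Fin m => degY (pb.P p.1 p.2))
      (Finset.mem_univ (i, j)))).trans ((le_max_right _ _).trans (le_max_right _ _))

theorem eval_rieszX {S : MatSeq n m} {D r : ℕ} {W : Fin r → Matrix (Fin m) (Fin m) ℝ}
    {x : Fin r → Fin n → ℝ} (hD : pb.kx ≤ D)
    (hS : ∀ α : Fin n →₀ ℕ, α.degree ≤ D → ∀ a b, S α a b = ∑ i, (∏ c, x i c ^ α c) * W i a b)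
    (y : Fin l → ℝ) :
    MvPolynomial.eval y (pb.rieszX S) = ∑ i, (pb.PAt y (x i) * W i).trace := by
  simp only [rieszX, map_sum, eval_monomial', Matrix.trace, Matrix.diag, Matrix.mul_apply, PAt,
    Matrix.map_apply, eval_sumElim, Finset.sum_mul]
  rw [Finset.sum_comm (s := (Finset.univ : Finset (Fin r)))]
  refine Finset.sum_congr rfl fun a _ => ?_
  rw [Finset.sum_comm (s := (Finset.univ : Finset (Fin r)))]
  refine Finset.sum_congr rfl fun b _ => ?_
  rw [Finset.sum_comm (s := (Finset.univ : Finset (Fin r)))]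
  refine Finset.sum_congr rfl fun γ hγ => ?_
  rw [hS _ ((pb.xPart_degree_le a b hγ).trans hD), Finset.mul_sum, Finset.sum_mul]
  exact Finset.sum_congr rfl fun i _ => by ring

theorem evalAt_rieszY {σ : (Fin l →₀ ℕ) → ℝ} {D r : ℕ} {w : Fin r → ℝ} {y : Fin r → Fin l → ℝ}
    (hD : pb.ky ≤ D)
    (hσ : ∀ α : Fin l →₀ ℕ, α.degree ≤ D → σ α = ∑ j, w j * ∏ c, y j c ^ α c)
    (x : Fin n → ℝ) : (pb.rieszY σ).evalAt x = ∑ j, w j • pb.PAt (y j) x := by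
  ext a b
  simp only [rieszY, PolyMat.evalAt, Matrix.map_apply, Matrix.of_apply, map_sum, eval_monomial',
    Matrix.sum_apply, Matrix.smul_apply, PAt, eval_sumElim, smul_eq_mul, Finset.mul_sum]
  rw [Finset.sum_comm (s := (Finset.univ : Finset (Fin r)))]
  refine Finset.sum_congr rfl fun γ hγ => ?_
  rw [hσ _ ((pb.yPart_degree_le a b hγ).trans hD), Finset.mul_sum, Finset.sum_mul]
  exact Finset.sum_congr rfl fun i _ => by ring

theorem rieszFun_eq_sum {σ : (Fin l →₀ ℕ) → ℝ} {D r : ℕ} {w : Fin r → ℝ} {y : Fin r → Fin l → ℝ}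
    (hσ : ∀ α : Fin l →₀ ℕ, α.degree ≤ D → σ α = ∑ j, w j * ∏ c, y j c ^ α c)
    {h : MvPolynomial (Fin l) ℝ} (hh : h.totalDegree ≤ D) :
    rieszFun σ h = ∑ j, w j * MvPolynomial.eval (y j) h := by
  simp only [rieszFun, MvPolynomial.eval_eq', Finset.mul_sum]
  rw [Finset.sum_comm]
  refine Finset.sum_congr rfl fun γ hγ => ?_
  rw [hσ _ ((degree_le_totalDegree hγ).trans hh), Finset.mul_sum]
  exact Finset.sum_congr rfl fun i _ => by ring

/-! ### The sets `𝒴` and the primal and dual bounds -/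

/-- Lets the matrix results, with `m = 1`, serve for the variable `y`. -/
theorem Y_eq_psdSet : pb.Y = psdSet pb.Θ := by
  ext y
  have h : pb.Θ.evalAt y = Matrix.diagonal fun i => MvPolynomial.eval y (pb.θ i) := by
    ext i j
    simp only [PolyMat.evalAt, Θ, Matrix.map_apply, Matrix.diagonal_apply]
    split_ifs <;> simp
  simp only [Y, psdSet, Set.mem_ofPred_eq, h, Matrix.posSemidef_diagonal_iff]

theorem measurableSet_Y : MeasurableSet pb.Y := by
  have : pb.Y = ⋂ i, {y | 0 ≤ MvPolynomial.eval y (pb.θ i)} := by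
    ext y
    simp [Y]
  rw [this]
  exact (isClosed_iInter fun i =>
    isClosed_le continuous_const (MvPolynomial.continuous_eval _)).measurableSet

/-- Evaluation of the quadratic module certificate for `f - ρ - ℒ_S(P)` at a point of `𝒴`. -/
theorem trace_sum_le_of_primalFeasible {k : ℕ} {ρ : ℝ} {S : MatSeq n m} {D r : ℕ}
    {W : Fin r → Matrix (Fin m) (Fin m) ℝ} {x : Fin r → Fin n → ℝ}
    (h : pb.PrimalFeasible k ρ S) (hD : pb.kx ≤ D)
    (hS : ∀ α : Fin n →₀ ℕ, α.degree ≤ D → ∀ a b, S α a b = ∑ i, (∏ c, x i c ^ α c) * W i a b)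
    {y : Fin l → ℝ} (hy : y ∈ pb.Y) :
    ∑ i, (pb.PAt y (x i) * W i).trace ≤ MvPolynomial.eval y pb.f - ρ := by
  have h1 := (posSemidef_of_mem_truncQuadModule h.1 (pb.Y_eq_psdSet ▸ hy)).diag_nonneg (i := 0)
  simp only [PolyMat.evalAt, Matrix.map_apply, Matrix.of_apply, map_sub, MvPolynomial.eval_C,
    pb.eval_rieszX hD hS] at h1
  linarith

theorem primalVal_le_optVal {k : ℕ} {ρ : ℝ} {S : MatSeq n m} {D r : ℕ}
    {W : Fin r → Matrix (Fin m) (Fin m) ℝ} {x : Fin r → Fin n → ℝ}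
    (h : pb.IsPrimalOptimal k ρ S) (hD : pb.kx ≤ D) (hrep : IsAtomicMatRep pb.X S D W x) :
    pb.primalVal k ≤ pb.optVal := by
  obtain ⟨hW, -, hx, hS⟩ := isAtomicMatRep_iff.mp hrep
  rw [← h.2]
  refine le_iInf₂ fun y hy => EReal.coe_le_coe_iff.mpr ?_
  have h1 := pb.trace_sum_le_of_primalFeasible h.1 hD hS hy.1
  have h2 : 0 ≤ ∑ i, (pb.PAt y (x i) * W i).trace :=
    Finset.sum_nonneg fun i _ => trace_mul_nonneg_of_posSemidef (hy.2 _ (hx i)) (hW i)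
  linarith

/-- Jensen's inequality for `-P(·, x)`, `x ∈ 𝒳`. -/
theorem IsConvex.posSemidef_PAt_sum {pb : Problem l n m q s} (hC : pb.IsConvex) {x : Fin n → ℝ}
    (hx : x ∈ pb.X) {r : ℕ} {w : Fin r → ℝ} {y : Fin r → Fin l → ℝ} (hw : ∀ j, 0 ≤ w j)
    (hw1 : ∑ j, w j = 1) (h : (∑ j, w j • pb.PAt (y j) x).PosSemidef) :
    (pb.PAt (∑ j, w j • y j) x).PosSemidef := by
  have hherm : (pb.PAt (∑ j, w j • y j) x).IsHermitian := by
    ext i j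
    simp [PAt, pb.P_symm.apply i j]
  refine Matrix.PosSemidef.of_dotProduct_mulVec_nonneg hherm fun ξ => ?_
  -- Fixing `ξ` reduces PSD-convexity to scalar convexity. The endpoint weights are treated apart,
  -- as `P_convex` covers only `t ∈ (0, 1)`.
  have hconv : ConvexOn ℝ Set.univ fun y => -(ξ ⬝ᵥ (pb.PAt y x).mulVec ξ) := by
    refine ⟨convex_univ, fun y₁ _ y₂ _ a b ha hb hab => ?_⟩
    rcases ha.eq_or_lt with rfl | ha
    · obtain rfl : b = 1 := by linarith
      simp
    rcases hb.eq_or_lt with rfl | hb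
    · obtain rfl : a = 1 := by linarith
      simp
    obtain rfl : b = 1 - a := by linarith
    have h1 := (hC.P_convex x hx y₁ y₂ a ⟨ha, by linarith⟩).dotProduct_mulVec_nonneg ξ
    simp only [star_trivial, Matrix.sub_mulVec, Matrix.add_mulVec, Matrix.smul_mulVec,
      Matrix.neg_mulVec, dotProduct_sub, dotProduct_add, dotProduct_smul, dotProduct_neg,
      smul_eq_mul] at h1 ⊢
    linarith
  have h1 := hconv.map_sum_le (t := Finset.univ) (w := w) (p := y) (fun j _ => hw j) hw1
    fun j _ => Set.mem_univ _
  have h2 := h.dotProduct_mulVec_nonneg ξ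
  simp only [star_trivial, Matrix.sum_mulVec, Matrix.smul_mulVec, dotProduct_sum,
    dotProduct_smul, smul_eq_mul, mul_neg, Finset.sum_neg_distrib] at h1 h2 ⊢
  linarith

/-- Jensen's inequality for each of `f`, `-θ_i` and `-P(·, x)`. For the last, `∑ w_j P(y_j, x) =
ℋ_s(P)(x)` is PSD on `𝒳` by its quadratic module certificate. -/
theorem IsConvex.sum_mem_feasible {pb : Problem l n m q s} (hC : pb.IsConvex) {k D r : ℕ}
    {σ : (Fin l →₀ ℕ) → ℝ} {w : Fin r → ℝ} {y : Fin r → Fin l → ℝ}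
    (h : pb.DualFeasible k σ) (hD : pb.ky ≤ D) (hrep : IsAtomicProbRep pb.Y σ D w y) :
    ∑ j, w j • y j ∈ pb.feasible ∧
      MvPolynomial.eval (∑ j, w j • y j) pb.f ≤ rieszFun σ pb.f := by
  obtain ⟨hw, -, hy, hw1, hσ⟩ := (isAtomicProbRep_iff pb.measurableSet_Y).mp hrep
  refine ⟨⟨fun i => ?_, fun x hx => ?_⟩, ?_⟩
  · have h1 := (hC.θ_convex i).map_sum_le (t := Finset.univ) (w := w) (p := y)
      (fun j _ => (hw j).le) hw1 fun j _ => Set.mem_univ _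
    have h2 : 0 ≤ ∑ j, w j * MvPolynomial.eval (y j) (pb.θ i) :=
      Finset.sum_nonneg fun j _ => mul_nonneg (hw j).le (hy j i)
    simp only [smul_eq_mul, mul_neg, Finset.sum_neg_distrib] at h1
    linarith
  · refine hC.posSemidef_PAt_sum hx (fun j => (hw j).le) hw1 ?_
    rw [← pb.evalAt_rieszY hD hσ]
    exact posSemidef_of_mem_truncQuadModule h.2.2 hx
  · rw [rieszFun_eq_sum hσ ((le_max_left _ _).trans hD)]
    exact hC.f_convex.map_sum_le (t := Finset.univ) (w := w) (p := y)
      (fun j _ => (hw j).le) hw1 fun j _ => Set.mem_univ _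

theorem IsConvex.optVal_le_dualVal {pb : Problem l n m q s} (hC : pb.IsConvex) {k D r : ℕ}
    {σ : (Fin l →₀ ℕ) → ℝ} {w : Fin r → ℝ} {y : Fin r → Fin l → ℝ}
    (h : pb.IsDualOptimal k σ) (hD : pb.ky ≤ D) (hrep : IsAtomicProbRep pb.Y σ D w y) :
    pb.optVal ≤ pb.dualVal k := by
  obtain ⟨hf, hle⟩ := hC.sum_mem_feasible h.1 hD hrep
  rw [← h.2]
  exact (iInf₂_le _ hf).trans (EReal.coe_le_coe_iff.mpr hle)

theorem exists_atomicProbRep {k t : ℕ} {σ : (Fin l →₀ ℕ) → ℝ} (h : pb.DualFeasible k σ)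
    (hflat : pb.DualFlat k σ t) :
    ∃ (r : ℕ) (w : Fin r → ℝ) (y : Fin r → Fin l → ℝ),
      IsAtomicProbRep pb.Y σ (2 * t) w y := by
  classical
  have hΘ : pb.Θ.IsSymm := Matrix.isSymm_diagonal _
  obtain ⟨r, W, y, hrep⟩ := exists_atomicMatRep_of_flatAt hΘ h.1 hflat.2.1 rfl hflat.2.2
  obtain ⟨hW, hinj, hy, hσ⟩ := isAtomicMatRep_iff.mp hrep
  -- The `1 × 1` weights are only known to be nonnegative; atoms of weight zero are dropped.
  let e : Fin (Fintype.card {i // 0 < W i 0 0}) ≃ {i // 0 < W i 0 0} :=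
    (Fintype.equivFin _).symm
  have hσ' : ∀ α : Fin l →₀ ℕ, α.degree ≤ 2 * t →
      σ α = ∑ j, W (e j) 0 0 * ∏ c, y (e j) c ^ α c := by
    intro α hα
    rw [e.sum_comp fun i => W i 0 0 * ∏ c, y i c ^ α c,
      ← Finset.sum_subtype (Finset.univ.filter fun i => 0 < W i 0 0) (by simp)
        fun i => W i 0 0 * ∏ c, y i c ^ α c, Finset.sum_filter_of_ne]
    · exact (hσ α hα 0 0).trans (Finset.sum_congr rfl fun i _ => mul_comm _ _)
    · intro i _ hi
      exact (hW i).diag_nonneg.lt_of_ne' (left_ne_zero_of_mul hi)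
  refine ⟨_, fun j => W (e j) 0 0, fun j => y (e j),
    (isAtomicProbRep_iff pb.measurableSet_Y).mpr ⟨fun j => (e j).2,
      hinj.comp (Subtype.val_injective.comp e.injective),
      fun j => pb.Y_eq_psdSet ▸ hy _, ?_, hσ'⟩⟩
  -- The normalization `ℋ_s(1) = 1` is the total mass.
  have h1 := h.2.1
  rw [rieszFun_eq_sum hσ' (by simp)] at h1
  simpa using h1

theorem kx_le_of_primalFlat {k t : ℕ} {S : MatSeq n m} (h : pb.PrimalFlat k S t) :
    pb.kx ≤ 2 * t :=
  (le_two_mul_ceilHalf _).trans (Nat.mul_le_mul_left 2 h.1)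

theorem ky_le_of_dualFlat {k t : ℕ} {σ : (Fin l →₀ ℕ) → ℝ} (h : pb.DualFlat k σ t) :
    pb.ky ≤ 2 * t :=
  (le_two_mul_ceilHalf _).trans (Nat.mul_le_mul_left 2 h.1)

end Problem

end RobustPMI

theorem mainTheorem11 {l n m q s : ℕ} (pb : RobustPMI.Problem l n m q s) (k : ℕ)
    (hk : max (RobustPMI.ceilHalf pb.kx) (RobustPMI.ceilHalf pb.ky) ≤ k) :
    -- (i)
    (∀ (ρ : ℝ) (S : RobustPMI.MatSeq n m) (t₁ : ℕ),
      pb.IsPrimalOptimal k ρ S → pb.PrimalFlat k S t₁ →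
        (∃ (r : ℕ) (W : Fin r → Matrix (Fin m) (Fin m) ℝ) (x : Fin r → Fin n → ℝ),
          RobustPMI.IsAtomicMatRep pb.X S (2 * t₁) W x) ∧
        pb.primalVal k ≤ pb.optVal) ∧
    -- (ii)
    (pb.IsConvex → ∀ (σ : (Fin l →₀ ℕ) → ℝ) (t₂ : ℕ),
      pb.IsDualOptimal k σ → pb.DualFlat k σ t₂ →
        (∃ (r : ℕ) (w : Fin r → ℝ) (y : Fin r → Fin l → ℝ),
          RobustPMI.IsAtomicProbRep pb.Y σ (2 * t₂) w y) ∧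
        pb.optVal ≤ pb.dualVal k) ∧
    -- (iii), (iv), (v)
    (pb.IsConvex → ∀ (ρ : ℝ) (S : RobustPMI.MatSeq n m) (σ : (Fin l →₀ ℕ) → ℝ) (t₁ t₂ : ℕ),
      pb.IsPrimalOptimal k ρ S → pb.IsDualOptimal k σ →
      pb.PrimalFlat k S t₁ → pb.DualFlat k σ t₂ → pb.primalVal k = pb.dualVal k →
        (pb.primalVal k = pb.optVal ∧ pb.dualVal k = pb.optVal) ∧
        ∀ (r₁ : ℕ) (W : Fin r₁ → Matrix (Fin m) (Fin m) ℝ) (x : Fin r₁ → Fin n → ℝ)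
          (r₂ : ℕ) (w : Fin r₂ → ℝ) (y : Fin r₂ → Fin l → ℝ),
          RobustPMI.IsAtomicMatRep pb.X S (2 * t₁) W x →
          RobustPMI.IsAtomicProbRep pb.Y σ (2 * t₂) w y →
            pb.IsOptimal (∑ j, w j • y j) ∧
            ∀ (d : Fin r₁ → ℕ) (v : (i : Fin r₁) → Fin (d i) → Fin m → ℝ),
              (∀ i, W i = ∑ a, Matrix.vecMulVec (v i a) (v i a)) →
                ∀ i a, (pb.PAt (∑ j, w j • y j) (x i)).mulVec (v i a) = 0) := by
  refine ⟨fun ρ S t₁ hP hF => ?_, fun hC σ t₂ hD hF => ?_, fun hC ρ S σ t₁ t₂ hP hD hF₁ hF₂ heq => ?_⟩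
  · obtain ⟨r, W, x, hrep⟩ :=
      RobustPMI.exists_atomicMatRep_of_flatAt pb.G_symm hP.1.2 hF.2.1 rfl hF.2.2
    exact ⟨⟨r, W, x, hrep⟩, pb.primalVal_le_optVal hP (pb.kx_le_of_primalFlat hF) hrep⟩
  · obtain ⟨r, w, y, hrep⟩ := pb.exists_atomicProbRep hD.1 hF
    exact ⟨⟨r, w, y, hrep⟩, hC.optVal_le_dualVal hD (pb.ky_le_of_dualFlat hF) hrep⟩
  · obtain ⟨r, W, x, hrep⟩ :=
      RobustPMI.exists_atomicMatRep_of_flatAt pb.G_symm hP.1.2 hF₁.2.1 rfl hF₁.2.2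
    obtain ⟨r', w', y', hrep'⟩ := pb.exists_atomicProbRep hD.1 hF₂
    have hle := pb.primalVal_le_optVal hP (pb.kx_le_of_primalFlat hF₁) hrep
    have hge := hC.optVal_le_dualVal hD (pb.ky_le_of_dualFlat hF₂) hrep'
    have hp : pb.primalVal k = pb.optVal := le_antisymm hle (heq ▸ hge)
    refine ⟨⟨hp, heq ▸ hp⟩, fun r₁ W x r₂ w y hW hw => ?_⟩
    obtain ⟨hfeas, hfle⟩ := hC.sum_mem_feasible hD.1 (pb.ky_le_of_dualFlat hF₂) hw
    -- Equal optimal values close the chain `ρ ≤ ρ + ∑ tr(P(ȳ, x_i) W_i) ≤ f(ȳ) ≤ ℋ_s(f) = ρ`, for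
    -- whichever representing measures are given.
    have hρ : ρ = RobustPMI.rieszFun σ pb.f :=
      EReal.coe_eq_coe_iff.mp (by rw [hP.2, hD.2, heq])
    obtain ⟨hWpsd, -, hx, hS⟩ := RobustPMI.isAtomicMatRep_iff.mp hW
    have htr := pb.trace_sum_le_of_primalFeasible hP.1 (pb.kx_le_of_primalFlat hF₁) hS hfeas.1
    have hnonneg : ∀ i, 0 ≤ (pb.PAt (∑ j, w j • y j) (x i) * W i).trace := fun i =>
      RobustPMI.trace_mul_nonneg_of_posSemidef (hfeas.2 _ (hx i)) (hWpsd i)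
    have hsum := Finset.sum_nonneg fun i (_ : i ∈ Finset.univ) => hnonneg i
    refine ⟨⟨hfeas, ?_⟩, fun d v hv i a => ?_⟩
    · rw [← hp, ← hP.2, EReal.coe_eq_coe_iff]
      linarith
    · have hzero := (Finset.sum_eq_zero_iff_of_nonneg fun i _ => hnonneg i).mp
        (le_antisymm (by linarith) hsum) i (Finset.mem_univ i)
      -- The vanishing trace is a sum of nonnegative forms `vᵀ P v`, so each is zero, and a PSD
      -- matrix kills its isotropic vectors.
      rw [hv i, RobustPMI.trace_mul_vecMulVec_sum] at hzero
      have hpos : ∀ b, 0 ≤ v i b ⬝ᵥ (pb.PAt (∑ j, w j • y j) (x i)).mulVec (v i b) := fun b => by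
        simpa using (hfeas.2 _ (hx i)).dotProduct_mulVec_nonneg (v i b)
      have hva := (Finset.sum_eq_zero_iff_of_nonneg fun b _ => hpos b).mp hzero a
        (Finset.mem_univ a)
      exact ((hfeas.2 _ (hx i)).dotProduct_mulVec_zero_iff (v i a)).mp (by simpa using hva)
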